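/- Let $\mu:P\to M$ be a smooth principal $G$-bundle, where $G$ is a (finite-dimensional, real) Lie group acting on $P$ from the right by $\kappa(p,g)=pg$; write $\kappa_p=\kappa(p,\cdot)$, $\kappa_g=\kappa(\cdot,g)$, and let $T_eG$ be the Lie algebra of $G$. For a manifold $N$, let $Aut_0TN$ be the group of smooth automorphisms of the vector bundle $TN$ covering $\mathrm{id}_N$. Let $Aut_{TG}TP\subset Aut_0TP$ be the subgroup of those $A$ with $A(pg)\circ\Phi_{(g,X)}=\Phi_{(g,X)}\circ A(p)$ for all $p\in P$, $g\in G$, $X\in T_eG$, where $\Phi_{(g,X)}(v_p)=T\kappa_g(p)\bigl(v_p+T\kappa_p(e)X\bigr)$, and let $Aut_NTP\subset Aut_{TG}TP$ be the subgroup of those $A$ for which $A(p)-\mathrm{id}_{T_pP}$ takes values in $\operatorname{Ker}T\mu(p)$ for every $p$. Let $Conn\,P(M,G)$ be the set of connections, i.e. of smooth $T_eG$-valued one-forms $\alpha$ on $P$ with $\alpha_p\circ T\kappa_p(e)=\mathrm{id}_{T_eG}$ and $\alpha_{pg}\circ T\kappa_g(p)=\mathrm{Ad}_{g^{-1}}\circ\alpha_p$.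 For a connection $\alpha$ let $\Gamma_\alpha(p):T_{\mu(p)}M\to\operatorname{Ker}\alpha_p$ be the inverse of the restriction of $T\mu(p)$ to $\operatorname{Ker}\alpha_p$. Let $\lambda:Aut_{TG}TP\to Aut_0TM$ be the group morphism determined by $\lambda(A)(\mu(p))\,T\mu(p)v=T\mu(p)A(p)v$ for $v\in T_pP$, and let $\sigma_\alpha:Aut_0TM\to Aut_{TG}TP$ be the group morphism $\sigma_\alpha(\tilde A)(p)=T\kappa_p(e)\circ\alpha_p+\Gamma_\alpha(p)\circ\tilde A(\mu(p))\circ T\mu(p)$. The group $Aut_{TG}TP$ acts on $Conn\,P(M,G)$ from the left by $\phi_A(\alpha)_p=\alpha_p\circ A(p)^{-1}$. Then: (i) this action of $Aut_{TG}TP$ is transitive: for any connections $\alpha,\alpha'$ there is $A\in Aut_{TG}TP$ with $\phi_A(\alpha)=\alpha'$; (ii) $A(p)\circ\Gamma_\alpha(p)=\Gamma_{\phi_A(\alpha)}(p)\circ\lambda(A)(\mu(p))$ for all connections $\alpha$, all $A\in Aut_{TG}TP$ and all $p\in P$; (iii) the action restricted to the subgroup $Aut_NTP$ is free and transitive (transitivity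 being understood as in (i)); (iv) for every connection $\alpha$, the stabilizer of $\alpha$ in $Aut_{TG}TP$ is the subgroup $\sigma_\alpha(Aut_0TM)$. -/

import Mathlib

open scoped Manifold ContDiff

noncomputable section

section TangentAut

variable (E : Type*) [NormedAddCommGroup E] [NormedSpace ℝ E]
  (M : Type*) [TopologicalSpace M] [ChartedSpace E M] [IsManifold 𝓘(ℝ, E) ∞ M]

/-- A smooth automorphism of the tangent bundle `TM` covering the identity map of `M`: a family of
linear isomorphisms `A x : T_x M → T_x M` such that the induced bijection `TM → TM` and its inverse
are smooth. -/
@[ext]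
structure TangentAut where
  toFun : ∀ x : M, TangentSpace 𝓘(ℝ, E) x ≃ₗ[ℝ] TangentSpace 𝓘(ℝ, E) x
  contMDiff_toFun : ContMDiff 𝓘(ℝ, E).tangent 𝓘(ℝ, E).tangent ∞
    (fun v : TangentBundle 𝓘(ℝ, E) M => (⟨v.1, toFun v.1 v.2⟩ : TangentBundle 𝓘(ℝ, E) M))
  contMDiff_invFun : ContMDiff 𝓘(ℝ, E).tangent 𝓘(ℝ, E).tangent ∞
    (fun v : TangentBundle 𝓘(ℝ, E) M =>
      (⟨v.1, (toFun v.1).symm v.2⟩ : TangentBundle 𝓘(ℝ, E) M))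

namespace TangentAut

variable {E M}

instance : CoeFun (TangentAut E M)
    (fun _ => ∀ x : M, TangentSpace 𝓘(ℝ, E) x ≃ₗ[ℝ] TangentSpace 𝓘(ℝ, E) x) := ⟨toFun⟩

theorem ext_apply {A B : TangentAut E M}
    (h : ∀ (x : M) (v : TangentSpace 𝓘(ℝ, E) x), A x v = B x v) : A = B :=
  TangentAut.ext (funext fun x => LinearEquiv.ext (h x))

/-- The group of automorphisms, the product being composition. -/
instance : Group (TangentAut E M) where
  mul A B := ⟨fun x => (B x).trans (A x), A.contMDiff_toFun.comp B.contMDiff_toFun,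
    B.contMDiff_invFun.comp A.contMDiff_invFun⟩
  one := ⟨fun _ => LinearEquiv.refl ℝ _, contMDiff_id, contMDiff_id⟩
  inv A := ⟨fun x => (A x).symm, A.contMDiff_invFun, A.contMDiff_toFun⟩
  mul_assoc _ _ _ := rfl
  one_mul _ := rfl
  mul_one _ := rfl
  inv_mul_cancel A := ext_apply fun x v => (A x).symm_apply_apply v

theorem mul_apply (A B : TangentAut E M) (x : M) (v : TangentSpace 𝓘(ℝ, E) x) :
    (A * B) x v = A x (B x v) := rfl

theorem one_apply (x : M) (v : TangentSpace 𝓘(ℝ, E) x) : (1 : TangentAut E M) x v = v := rfl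

theorem inv_apply (A : TangentAut E M) (x : M) (v : TangentSpace 𝓘(ℝ, E) x) :
    A⁻¹ x v = (A x).symm v := rfl

theorem apply_inv_apply (A : TangentAut E M) (x : M) (v : TangentSpace 𝓘(ℝ, E) x) :
    A x (A⁻¹ x v) = v := (A x).apply_symm_apply v

end TangentAut

end TangentAut

section Ad

variable {EG : Type*} [NormedAddCommGroup EG] [NormedSpace ℝ EG]
  {G : Type*} [TopologicalSpace G] [ChartedSpace EG G] [Group G]

/-- The adjoint action `Ad_g : T_e G → T_e G`, the derivative at `e` of `h ↦ g h g⁻¹`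
(which maps `e` to `e`). -/
def Ad (g : G) : GroupLieAlgebra 𝓘(ℝ, EG) G →L[ℝ] GroupLieAlgebra 𝓘(ℝ, EG) G :=
  (mfderiv 𝓘(ℝ, EG) 𝓘(ℝ, EG) (fun h : G => g * h * g⁻¹) 1 : EG →L[ℝ] EG)

end Ad

/-- A smooth principal `G`-bundle `P` over `M`: a smooth projection `proj`, a smooth right action
`act p g = pg` of `G` on `P` along the fibres of `proj`, and around each point of `M` a smooth
local trivialization `proj ⁻¹ U ≃ U × G` which is equivariant. -/
structure SmoothPrincipalBundle
    (EG : Type*) [NormedAddCommGroup EG] [NormedSpace ℝ EG]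
    (G : Type*) [TopologicalSpace G] [ChartedSpace EG G] [Group G]
    (EP : Type*) [NormedAddCommGroup EP] [NormedSpace ℝ EP]
    (P : Type*) [TopologicalSpace P] [ChartedSpace EP P]
    (EM : Type*) [NormedAddCommGroup EM] [NormedSpace ℝ EM]
    (M : Type*) [TopologicalSpace M] [ChartedSpace EM M] where
  proj : P → M
  act : P → G → P
  act_one : ∀ p, act p 1 = p
  act_mul : ∀ p g h, act p (g * h) = act (act p g) h
  proj_act : ∀ p g, proj (act p g) = proj p
  contMDiff_proj : ContMDiff 𝓘(ℝ, EP) 𝓘(ℝ, EM) ∞ proj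
  contMDiff_act : ContMDiff (𝓘(ℝ, EP).prod 𝓘(ℝ, EG)) 𝓘(ℝ, EP) ∞ (fun x : P × G => act x.1 x.2)
  exists_trivialization : ∀ m : M, ∃ e : Bundle.Trivialization G proj, m ∈ e.baseSet ∧
    ContMDiffOn 𝓘(ℝ, EP) (𝓘(ℝ, EM).prod 𝓘(ℝ, EG)) ∞ e e.source ∧
    ContMDiffOn (𝓘(ℝ, EM).prod 𝓘(ℝ, EG)) 𝓘(ℝ, EP) ∞ e.toOpenPartialHomeomorph.symm e.target ∧
    ∀ p ∈ e.source, ∀ g : G, e (act p g) = ((e p).1, (e p).2 * g)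

namespace SmoothPrincipalBundle

variable {EG : Type*} [NormedAddCommGroup EG] [NormedSpace ℝ EG]
  {G : Type*} [TopologicalSpace G] [ChartedSpace EG G] [Group G]
  {EP : Type*} [NormedAddCommGroup EP] [NormedSpace ℝ EP]
  {P : Type*} [TopologicalSpace P] [ChartedSpace EP P]
  {EM : Type*} [NormedAddCommGroup EM] [NormedSpace ℝ EM]
  {M : Type*} [TopologicalSpace M] [ChartedSpace EM M]
  (B : SmoothPrincipalBundle EG G EP P EM M)

/-- `Tκ_p(e) : T_e G → T_p P`, the derivative at `e` of `g ↦ pg`. -/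
def tOrbit (p : P) : GroupLieAlgebra 𝓘(ℝ, EG) G →L[ℝ] TangentSpace 𝓘(ℝ, EP) p :=
  (mfderiv 𝓘(ℝ, EG) 𝓘(ℝ, EP) (B.act p) 1 : EG →L[ℝ] EP)

/-- `Tκ_g(p) : T_p P → T_{pg} P`, the derivative at `p` of `q ↦ qg`. -/
def tAct (g : G) (p : P) : TangentSpace 𝓘(ℝ, EP) p →L[ℝ] TangentSpace 𝓘(ℝ, EP) (B.act p g) :=
  mfderiv 𝓘(ℝ, EP) 𝓘(ℝ, EP) (fun q => B.act q g) p

/-- `Tμ(p) : T_p P → T_{μ(p)} M`, the derivative at `p` of the bundle projection `μ`. -/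
def tProj (p : P) : TangentSpace 𝓘(ℝ, EP) p →L[ℝ] TangentSpace 𝓘(ℝ, EM) (B.proj p) :=
  mfderiv 𝓘(ℝ, EP) 𝓘(ℝ, EM) B.proj p

/-- The action `Φ_{(g,X)}(v) = Tκ_g(p)(v + Tκ_p(e) X)` on `TP` of the tangent group `TG`, whose
elements are the pairs `(g, X)` in `G × T_e G`. -/
def tangentGroupAct (g : G) (X : GroupLieAlgebra 𝓘(ℝ, EG) G) (p : P)
    (v : TangentSpace 𝓘(ℝ, EP) p) : TangentSpace 𝓘(ℝ, EP) (B.act p g) :=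
  B.tAct g p (v + B.tOrbit p X)

section Groups

variable [IsManifold 𝓘(ℝ, EP) ∞ P]

/-- `Aut_{TG} TP`: the automorphisms of `TP` covering the identity of `P` that commute with the
action of the tangent group `TG`. -/
def autTG : Subgroup (TangentAut EP P) where
  carrier := {A | ∀ (g : G) (X : GroupLieAlgebra 𝓘(ℝ, EG) G) (p : P)
    (v : TangentSpace 𝓘(ℝ, EP) p),
    A (B.act p g) (B.tangentGroupAct g X p v) = B.tangentGroupAct g X p (A p v)}
  mul_mem' {A C} hA hC g X p v := by
    rw [TangentAut.mul_apply, hC, hA, TangentAut.mul_apply]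
  one_mem' _ _ _ _ := rfl
  inv_mem' {A} hA g X p v := by
    have h := hA g X p (A⁻¹ p v)
    rw [TangentAut.apply_inv_apply] at h
    rw [← h, TangentAut.inv_apply, LinearEquiv.symm_apply_apply]

/-- `Aut_N TP`: the elements of `Aut_{TG} TP` of the form `A(p) = id + B(p)` where `B(p)` takes
values in the vertical space `Ker Tμ(p)`. -/
def autN : Subgroup B.autTG where
  carrier := {A | ∀ (p : P) (v : TangentSpace 𝓘(ℝ, EP) p),
    (A : TangentAut EP P) p v - v ∈ LinearMap.ker (B.tProj p).toLinearMap}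
  mul_mem' {A C} hA hC p v := by
    have := add_mem (hA p ((C : TangentAut EP P) p v)) (hC p v)
    rwa [sub_add_sub_cancel] at this
  one_mem' p v := by
    change v - v ∈ _
    rw [sub_self]
    exact zero_mem _
  inv_mem' {A} hA p v := by
    have := neg_mem (hA p ((A : TangentAut EP P)⁻¹ p v))
    rwa [TangentAut.apply_inv_apply, neg_sub] at this

end Groups

/-- A connection on the principal bundle: a smooth `T_e G`-valued one-form `α` on `P` such that
`α_p ∘ Tκ_p(e) = id` and `α_{pg} ∘ Tκ_g(p) = Ad_{g⁻¹} ∘ α_p`. -/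
@[ext]
structure Conn [IsManifold 𝓘(ℝ, EP) ∞ P] where
  form : ∀ p : P, TangentSpace 𝓘(ℝ, EP) p →ₗ[ℝ] GroupLieAlgebra 𝓘(ℝ, EG) G
  contMDiff_form : ContMDiff (M' := EG) 𝓘(ℝ, EP).tangent 𝓘(ℝ, EG) ∞
    (fun v : TangentBundle 𝓘(ℝ, EP) P => form v.1 v.2)
  form_tOrbit : ∀ (p : P) (X : GroupLieAlgebra 𝓘(ℝ, EG) G), form p (B.tOrbit p X) = X
  form_tAct : ∀ (p : P) (g : G) (v : TangentSpace 𝓘(ℝ, EP) p),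
    form (B.act p g) (B.tAct g p v) = Ad g⁻¹ (form p v)

section Calculus

variable {E₁ : Type*} [NormedAddCommGroup E₁] [NormedSpace ℝ E₁]
  {M₁ : Type*} [TopologicalSpace M₁] [ChartedSpace E₁ M₁]
  {E₂ : Type*} [NormedAddCommGroup E₂] [NormedSpace ℝ E₂]
  {M₂ : Type*} [TopologicalSpace M₂] [ChartedSpace E₂ M₂]
  {E₃ : Type*} [NormedAddCommGroup E₃] [NormedSpace ℝ E₃]
  {M₃ : Type*} [TopologicalSpace M₃] [ChartedSpace E₃ M₃]

theorem mfderiv_congr_all {f f' : M₁ → M₂} {x x' : M₁} (hf : f = f') (hx : x = x') :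
    (mfderiv 𝓘(ℝ, E₁) 𝓘(ℝ, E₂) f x : E₁ →L[ℝ] E₂) = mfderiv 𝓘(ℝ, E₁) 𝓘(ℝ, E₂) f' x' := by
  subst hf hx; rfl

theorem mfderiv_comp_all {f : M₁ → M₂} {g : M₂ → M₃} {h : M₁ → M₃} {x : M₁} {y : M₂}
    (hg : MDifferentiableAt 𝓘(ℝ, E₂) 𝓘(ℝ, E₃) g y) (hf : MDifferentiableAt 𝓘(ℝ, E₁) 𝓘(ℝ, E₂) f x)
    (hy : f x = y) (hh : h =ᶠ[nhds x] g ∘ f) (v : E₁) :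
    ((mfderiv 𝓘(ℝ, E₁) 𝓘(ℝ, E₃) h x : E₁ →L[ℝ] E₃) v : E₃) =
      (mfderiv 𝓘(ℝ, E₂) 𝓘(ℝ, E₃) g y : E₂ →L[ℝ] E₃)
        ((mfderiv 𝓘(ℝ, E₁) 𝓘(ℝ, E₂) f x : E₁ →L[ℝ] E₂) v) := by
  subst hy
  have h1 : (mfderiv 𝓘(ℝ, E₁) 𝓘(ℝ, E₃) h x : E₁ →L[ℝ] E₃) =
      mfderiv 𝓘(ℝ, E₁) 𝓘(ℝ, E₃) (g ∘ f) x := hh.mfderiv_eq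
  rw [h1]
  exact congrArg (fun L : E₁ →L[ℝ] E₃ => L v) (mfderiv_comp x hg hf)

end Calculus

section Lemmas

theorem mdifferentiableAt_act_right (g : G) (p : P) :
    MDifferentiableAt 𝓘(ℝ, EP) 𝓘(ℝ, EP) (fun q => B.act q g) p :=
  ((B.contMDiff_act.comp (contMDiff_id.prodMk contMDiff_const)).mdifferentiable
    (by simp)).mdifferentiableAt

theorem mdifferentiableAt_act (p : P) (g : G) :
    MDifferentiableAt 𝓘(ℝ, EG) 𝓘(ℝ, EP) (B.act p) g :=
  ((B.contMDiff_act.comp (contMDiff_const.prodMk contMDiff_id)).mdifferentiable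
    (by simp)).mdifferentiableAt

theorem mdifferentiableAt_proj (p : P) : MDifferentiableAt 𝓘(ℝ, EP) 𝓘(ℝ, EM) B.proj p :=
  (B.contMDiff_proj.mdifferentiable (by simp)).mdifferentiableAt

theorem tProj_tAct (g : G) (p : P) (v : TangentSpace 𝓘(ℝ, EP) p) :
    (B.tProj (B.act p g) (B.tAct g p v) : EM) = B.tProj p v := by
  refine (mfderiv_comp_all (h := B.proj) (B.mdifferentiableAt_proj _)
    (B.mdifferentiableAt_act_right g p) rfl ?_ v).symm
  exact Filter.Eventually.of_forall fun q => (B.proj_act q g).symm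

theorem tProj_tOrbit (p : P) (X : GroupLieAlgebra 𝓘(ℝ, EG) G) : B.tProj p (B.tOrbit p X) = 0 := by
  have h := mfderiv_comp_all (h := fun _ : G => B.proj p) (B.mdifferentiableAt_proj p)
    (B.mdifferentiableAt_act p 1) (B.act_one p)
    (Filter.Eventually.of_forall fun g => (B.proj_act p g).symm) X
  refine h.symm.trans ?_
  rw [mfderiv_const]
  rfl

theorem tAct_one (p : P) (v : TangentSpace 𝓘(ℝ, EP) p) : (B.tAct 1 p v : EP) = v := by
  have h : (fun q => B.act q 1) = (id : P → P) := funext B.act_one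
  have := congrArg (fun L : EP →L[ℝ] EP => L v)
    ((mfderiv_congr_all h (rfl : p = p)).trans (mfderiv_id (I := 𝓘(ℝ, EP)) (x := p)))
  exact this

theorem tAct_tOrbit [LieGroup 𝓘(ℝ, EG) ∞ G] (g : G) (p : P) (X : GroupLieAlgebra 𝓘(ℝ, EG) G) :
    B.tAct g p (B.tOrbit p X) = B.tOrbit (B.act p g) (Ad g⁻¹ X) := by
  have hm : MDifferentiableAt 𝓘(ℝ, EG) 𝓘(ℝ, EG) (fun h : G => g⁻¹ * h * g⁻¹⁻¹) 1 :=
    ((((contMDiff_const (c := g⁻¹)).mul contMDiff_id).mul contMDiff_const).mdifferentiable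
      (n := ∞) (by simp)).mdifferentiableAt
  have h1 := mfderiv_comp_all (h := fun h => B.act p (h * g)) (B.mdifferentiableAt_act_right g p)
    (B.mdifferentiableAt_act p 1) (B.act_one p)
    (Filter.Eventually.of_forall fun h => B.act_mul p h g) X
  have h2 := mfderiv_comp_all (h := fun h => B.act p (h * g)) (B.mdifferentiableAt_act (B.act p g) 1)
    hm (by simp)
    (Filter.Eventually.of_forall fun h => by
      simp only [Function.comp_apply, ← B.act_mul]; congr 1; group) X
  exact h1.symm.trans h2

variable [IsManifold 𝓘(ℝ, EP) ∞ P]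

theorem tangentAut_congr (A : TangentAut EP P) {p q : P} (h : p = q) {v w : EP} (hv : v = w) :
    (A p v : EP) = A q w := by
  subst h hv; rfl

theorem autTG_tAct {A : TangentAut EP P} (hA : A ∈ B.autTG) (g : G) (p : P)
    (v : TangentSpace 𝓘(ℝ, EP) p) : A (B.act p g) (B.tAct g p v) = B.tAct g p (A p v) := by
  have := hA g 0 p v
  simpa [tangentGroupAct] using this

theorem autTG_tOrbit {A : TangentAut EP P} (hA : A ∈ B.autTG) (p : P)
    (X : GroupLieAlgebra 𝓘(ℝ, EG) G) : A p (B.tOrbit p X) = B.tOrbit p X := by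
  have h := hA 1 X p 0
  simp only [tangentGroupAct, map_zero, zero_add] at h
  have h2 := tangentAut_congr A (B.act_one p) (B.tAct_one p (B.tOrbit p X))
  exact h2.symm.trans (Eq.trans h (B.tAct_one p _))

theorem mem_autTG_of {A : TangentAut EP P}
    (h1 : ∀ (p : P) (X : GroupLieAlgebra 𝓘(ℝ, EG) G), A p (B.tOrbit p X) = B.tOrbit p X)
    (h2 : ∀ (g : G) (p : P) (v : TangentSpace 𝓘(ℝ, EP) p),
      A (B.act p g) (B.tAct g p v) = B.tAct g p (A p v)) : A ∈ B.autTG := by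
  intro g X p v
  rw [tangentGroupAct, tangentGroupAct, h2, map_add, h1]

variable {B} in
theorem Conn.ext_apply {α β : B.Conn} (h : ∀ (p : P) (v : TangentSpace 𝓘(ℝ, EP) p),
    α.form p v = β.form p v) : α = β :=
  Conn.ext (funext fun p => LinearMap.ext (h p))

/-- The left action `φ_A(α)_p = α_p ∘ A(p)⁻¹` of `Aut_{TG} TP` on connections. -/
instance : MulAction B.autTG B.Conn where
  smul A α :=
    { form := fun p => α.form p ∘ₗ ((A : TangentAut EP P) p).symm.toLinearMap
      contMDiff_form := α.contMDiff_form.comp (A : TangentAut EP P).contMDiff_invFun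
      form_tOrbit := fun p X => by
        have h := B.autTG_tOrbit (B.autTG.inv_mem A.2) p X
        exact (congrArg (α.form p) h).trans (α.form_tOrbit p X)
      form_tAct := fun p g v => by
        have h := B.autTG_tAct (B.autTG.inv_mem A.2) g p v
        exact (congrArg (α.form (B.act p g)) h).trans (α.form_tAct p g _) }
  one_smul _ := rfl
  mul_smul _ _ _ := rfl

theorem smul_form (A : B.autTG) (α : B.Conn) (p : P) (v : TangentSpace 𝓘(ℝ, EP) p) :
    (A • α).form p v = α.form p (((A : TangentAut EP P) p).symm v) := rfl

end Lemmas

section Lift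

theorem exists_section (m : M) : ∃ (U : Set M) (s : M → P) (γ : P → G), IsOpen U ∧ m ∈ U ∧
    ContMDiffOn 𝓘(ℝ, EM) 𝓘(ℝ, EP) ∞ s U ∧
    ContMDiffOn 𝓘(ℝ, EP) 𝓘(ℝ, EG) ∞ γ (B.proj ⁻¹' U) ∧
    (∀ x ∈ U, B.proj (s x) = x) ∧ (∀ p, B.proj p ∈ U → B.act (s (B.proj p)) (γ p) = p) := by
  obtain ⟨e, hm, he, he', hact⟩ := B.exists_trivialization m
  refine ⟨e.baseSet, fun x => e.toOpenPartialHomeomorph.symm (x, 1), fun p => (e p).2,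
    e.open_baseSet, hm, ?_, ?_, ?_, ?_⟩
  · refine he'.comp (contMDiff_id.prodMk contMDiff_const).contMDiffOn fun x hx => ?_
    exact e.mem_target.2 hx
  · rw [← e.source_eq]
    exact contMDiff_snd.comp_contMDiffOn he
  · intro x hx
    exact e.proj_symm_apply (e.mem_target.2 hx)
  · intro p hp
    have ht : (B.proj p, (1 : G)) ∈ e.target := e.mem_target.2 hp
    have hs : e.toOpenPartialHomeomorph.symm (B.proj p, 1) ∈ e.source :=
      e.toOpenPartialHomeomorph.map_target ht
    have hp' : p ∈ e.source := e.mem_source.2 hp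
    have h1 := hact _ hs (e p).2
    have h2 : e (e.toOpenPartialHomeomorph.symm (B.proj p, 1)) = (B.proj p, 1) :=
      e.apply_symm_apply ht
    rw [h2, one_mul, e.mk_proj_snd hp'] at h1
    refine e.injOn ?_ hp' h1
    rw [e.mem_source, B.proj_act]
    exact e.mem_source.1 hs

theorem proj_surjective : Function.Surjective B.proj := fun m => by
  obtain ⟨U, s, γ, -, hm, -, -, h, -⟩ := B.exists_section m
  exact ⟨s m, h m hm⟩

theorem exists_act_eq {p q : P} (h : B.proj p = B.proj q) : ∃ g, q = B.act p g := by
  obtain ⟨U, s, γ, -, hm, -, -, -, h'⟩ := B.exists_section (B.proj q)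
  refine ⟨(γ p)⁻¹ * γ q, ?_⟩
  have h1 := h' p (h ▸ hm)
  have h2 := h' q hm
  rw [h] at h1
  calc q = B.act (s (B.proj q)) (γ p * ((γ p)⁻¹ * γ q)) := by rw [mul_inv_cancel_left, h2]
    _ = _ := by rw [B.act_mul, h1]

theorem tProj_surjective (p : P) : Function.Surjective (B.tProj p) := fun w => by
  obtain ⟨U, s, γ, hU, hm, hs, -, h, h'⟩ := B.exists_section (B.proj p)
  have hsm : MDifferentiableAt 𝓘(ℝ, EM) 𝓘(ℝ, EP) s (B.proj p) :=
    (hs.contMDiffAt (hU.mem_nhds hm)).mdifferentiableAt (by simp)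
  have hs2 := (B.mdifferentiableAt_act_right (γ p) (s (B.proj p))).comp (B.proj p) hsm
  have := mfderiv_comp_all (h := fun x : M => x) (B.mdifferentiableAt_proj p) hs2 (h' p hm)
    (Filter.eventually_of_mem (hU.mem_nhds hm) fun x hx => by
      simp [B.proj_act, h x hx]) w
  refine ⟨_, this.symm.trans ?_⟩
  exact congrArg (fun L : EM →L[ℝ] EM => L w) (mfderiv_id (I := 𝓘(ℝ, EM)) (x := B.proj p))

theorem exists_tOrbit_of_tProj_eq_zero [LieGroup 𝓘(ℝ, EG) ∞ G] (p : P)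
    (v : TangentSpace 𝓘(ℝ, EP) p) (hv : B.tProj p v = 0) : ∃ X, v = B.tOrbit p X := by
  obtain ⟨U, s, γ, hU, hm, hs, hγ, h, h'⟩ := B.exists_section (B.proj p)
  have hsm : MDifferentiableAt 𝓘(ℝ, EM) 𝓘(ℝ, EP) s (B.proj p) :=
    (hs.contMDiffAt (hU.mem_nhds hm)).mdifferentiableAt (by simp)
  have hUp : B.proj ⁻¹' U ∈ nhds p := (hU.preimage B.contMDiff_proj.continuous).mem_nhds hm
  have hγm : MDifferentiableAt 𝓘(ℝ, EP) 𝓘(ℝ, EG) γ p :=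
    (hγ.contMDiffAt hUp).mdifferentiableAt (by simp)
  have hsp := hsm.comp p (B.mdifferentiableAt_proj p)
  have ha : MDifferentiableAt (𝓘(ℝ, EP).prod 𝓘(ℝ, EG)) 𝓘(ℝ, EP)
      (fun x : P × G => B.act x.1 x.2) (s (B.proj p), γ p) :=
    (B.contMDiff_act.mdifferentiable (by simp)).mdifferentiableAt
  have hid : (mfderiv 𝓘(ℝ, EP) 𝓘(ℝ, EP) (fun q : P => q) p : EP →L[ℝ] EP) =
      mfderiv 𝓘(ℝ, EP) 𝓘(ℝ, EP)
        ((fun x : P × G => B.act x.1 x.2) ∘ fun q => (s (B.proj q), γ q)) p :=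
    Filter.EventuallyEq.mfderiv_eq (Filter.eventually_of_mem hUp fun q hq => (h' q hq).symm)
  have hid' := (mfderiv_id (I := 𝓘(ℝ, EP)) (x := p)).symm.trans hid
  have h0 : (mfderiv 𝓘(ℝ, EP) 𝓘(ℝ, EP) (s ∘ B.proj) p : EP →L[ℝ] EP) v = (0 : EP) := by
    refine (mfderiv_comp_all hsm (B.mdifferentiableAt_proj p) rfl (Filter.EventuallyEq.refl _ _)
      v).trans ?_
    exact (congrArg (mfderiv 𝓘(ℝ, EM) 𝓘(ℝ, EP) s (B.proj p) : EM →L[ℝ] EP) hv).trans (map_zero _)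
  have h1 : (v : EP) = (mfderiv 𝓘(ℝ, EG) 𝓘(ℝ, EP) (B.act (s (B.proj p))) (γ p) : EG →L[ℝ] EP)
      ((mfderiv 𝓘(ℝ, EP) 𝓘(ℝ, EG) γ p : EP →L[ℝ] EG) v) := by
    refine (congrArg (fun L : EP →L[ℝ] EP => L v) hid').trans ?_
    refine (congrArg (fun L : EP →L[ℝ] EP => L v)
      (mfderiv_comp p (f := fun q => (s (B.proj q), γ q)) ha (hsp.prodMk hγm))).trans ?_
    have h2 := mfderiv_prodMk hsp hγm
    refine (congrArg (fun L : EP →L[ℝ] EP × EG => (mfderiv (𝓘(ℝ, EP).prod 𝓘(ℝ, EG)) 𝓘(ℝ, EP)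
      (fun x : P × G => B.act x.1 x.2) (s (B.proj p), γ p) : EP × EG →L[ℝ] EP) (L v)) h2).trans ?_
    refine (mfderiv_prod_eq_add_apply (I := 𝓘(ℝ, EP)) (I' := 𝓘(ℝ, EG)) ha).trans ?_
    refine (congrArg₂ (fun x y : EP => x + y) (?_ : _ = (0 : EP)) rfl).trans (zero_add _)
    exact (congrArg (mfderiv 𝓘(ℝ, EP) 𝓘(ℝ, EP) (fun q => B.act q (γ p)) (s (B.proj p)) :
      EP →L[ℝ] EP) h0).trans (map_zero _)
  have hm : MDifferentiableAt 𝓘(ℝ, EG) 𝓘(ℝ, EG) (fun k : G => (γ p)⁻¹ * k) (γ p) :=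
    (((contMDiff_const (c := (γ p)⁻¹)).mul contMDiff_id).mdifferentiable
      (n := ∞) (by simp)).mdifferentiableAt
  refine ⟨_, h1.trans (mfderiv_comp_all (B.mdifferentiableAt_act p 1) hm (by simp)
    (Filter.Eventually.of_forall fun k => ?_) _)⟩
  conv_rhs => rw [Function.comp_apply, ← h' p ‹_›, ← B.act_mul]
  rw [h' p ‹_›, mul_inv_cancel_left]

end Lift

section HorizontalLift

variable [IsManifold 𝓘(ℝ, EP) ∞ P] {B} (α : B.Conn)

/-- The horizontal space `Ker α_p`. -/
def Conn.horSpace (p : P) : Submodule ℝ (TangentSpace 𝓘(ℝ, EP) p) := LinearMap.ker (α.form p)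

theorem Conn.sub_mem_horSpace (p : P) (v : TangentSpace 𝓘(ℝ, EP) p) :
    v - B.tOrbit p (α.form p v) ∈ α.horSpace p := by
  change α.form p _ = 0
  rw [map_sub, α.form_tOrbit, sub_self]

variable [LieGroup 𝓘(ℝ, EG) ∞ G]

theorem Conn.tProj_bijective (p : P) :
    Function.Bijective ((B.tProj p).toLinearMap.domRestrict (α.horSpace p)) := by
  constructor
  · rw [← LinearMap.ker_eq_bot, LinearMap.ker_eq_bot']
    intro v hv
    obtain ⟨X, hX⟩ := B.exists_tOrbit_of_tProj_eq_zero p v hv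
    have h0 : α.form p v = 0 := v.2
    rw [hX, α.form_tOrbit] at h0
    rw [h0, map_zero] at hX
    exact Subtype.ext hX
  · intro w
    obtain ⟨v, hv⟩ := B.tProj_surjective p w
    refine ⟨⟨_, α.sub_mem_horSpace p v⟩, ?_⟩
    change B.tProj p (v - B.tOrbit p (α.form p v)) = w
    rw [map_sub, B.tProj_tOrbit, hv, sub_zero]

/-- The isomorphism `Γ_α(p) : T_{μ(p)} M → Ker α_p`, the inverse of the restriction of `Tμ(p)` to
the horizontal space. -/
def Conn.horLiftEquiv (p : P) : TangentSpace 𝓘(ℝ, EM) (B.proj p) ≃ₗ[ℝ] α.horSpace p :=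
  (LinearEquiv.ofBijective _ (α.tProj_bijective p)).symm

/-- The horizontal lift `Γ_α(p)` as a linear map `T_{μ(p)} M → T_p P`. -/
def Conn.horLift (p : P) : TangentSpace 𝓘(ℝ, EM) (B.proj p) →ₗ[ℝ] TangentSpace 𝓘(ℝ, EP) p :=
  (α.horSpace p).subtype ∘ₗ (α.horLiftEquiv p).toLinearMap

theorem Conn.form_horLift (p : P) (w : TangentSpace 𝓘(ℝ, EM) (B.proj p)) :
    α.form p (α.horLift p w) = 0 := (α.horLiftEquiv p w).2

theorem Conn.tProj_horLift (p : P) (w : TangentSpace 𝓘(ℝ, EM) (B.proj p)) :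
    B.tProj p (α.horLift p w) = w :=
  (LinearEquiv.ofBijective _ (α.tProj_bijective p)).apply_symm_apply w

theorem Conn.eq_horLift (p : P) (v : TangentSpace 𝓘(ℝ, EP) p) :
    v = B.tOrbit p (α.form p v) + α.horLift p (B.tProj p v) := by
  have h : α.horLiftEquiv p (B.tProj p v) = ⟨_, α.sub_mem_horSpace p v⟩ := by
    refine ((LinearEquiv.ofBijective _ (α.tProj_bijective p)).symm_apply_eq).2 ?_
    change _ = B.tProj p (v - B.tOrbit p (α.form p v))
    rw [map_sub, B.tProj_tOrbit, sub_zero]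
  have h2 : α.horLift p (B.tProj p v) = v - B.tOrbit p (α.form p v) := congrArg Subtype.val h
  rw [h2, add_sub_cancel]

/-- A vector is determined by its vertical component and its projection. -/
theorem Conn.ext_vector (p : P) {v w : TangentSpace 𝓘(ℝ, EP) p} (h1 : α.form p v = α.form p w)
    (h2 : B.tProj p v = B.tProj p w) : v = w := by
  rw [α.eq_horLift p v, α.eq_horLift p w, h1, h2]

theorem Conn.horLift_act (g : G) (p : P) (w : TangentSpace 𝓘(ℝ, EM) (B.proj (B.act p g)))
    (w' : TangentSpace 𝓘(ℝ, EM) (B.proj p)) (hw : (w : EM) = w') :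
    α.horLift (B.act p g) w = B.tAct g p (α.horLift p w') := by
  refine α.ext_vector _ ?_ ?_
  · rw [α.form_horLift, α.form_tAct, α.form_horLift, map_zero]
  · refine (α.tProj_horLift _ _).trans ?_
    exact hw.trans (Eq.trans (B.tProj_tAct g p _) (α.tProj_horLift p w')).symm

end HorizontalLift

section Lambda

variable [IsManifold 𝓘(ℝ, EP) ∞ P] [LieGroup 𝓘(ℝ, EG) ∞ G]

theorem tProj_apply_eq {A : TangentAut EP P} (hA : A ∈ B.autTG) {p q : P}
    (h : B.proj p = B.proj q) (v : TangentSpace 𝓘(ℝ, EP) p) (w : TangentSpace 𝓘(ℝ, EP) q)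
    (hvw : (B.tProj p v : EM) = B.tProj q w) :
    (B.tProj p (A p v) : EM) = B.tProj q (A q w) := by
  obtain ⟨g, rfl⟩ := B.exists_act_eq h
  have h1 : B.tProj (B.act p g) (w - B.tAct g p v) = 0 := by
    rw [map_sub]
    exact sub_eq_zero.2 (hvw.symm.trans (B.tProj_tAct g p v).symm)
  obtain ⟨X, hX⟩ := B.exists_tOrbit_of_tProj_eq_zero _ _ h1
  rw [sub_eq_iff_eq_add] at hX
  rw [hX, map_add, B.autTG_tOrbit hA, B.autTG_tAct hA, map_add, B.tProj_tOrbit, zero_add]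
  exact (B.tProj_tAct g p _).symm

theorem exists_lambdaMap {A : TangentAut EP P} (hA : A ∈ B.autTG) (m : M) :
    ∃ L : TangentSpace 𝓘(ℝ, EM) m →ₗ[ℝ] TangentSpace 𝓘(ℝ, EM) m,
      ∀ (p : P), B.proj p = m → ∀ v : TangentSpace 𝓘(ℝ, EP) p,
        (L (B.tProj p v : EM) : EM) = B.tProj p (A p v) := by
  obtain ⟨q, rfl⟩ := B.proj_surjective m
  obtain ⟨R, hR⟩ := LinearMap.exists_rightInverse_of_surjective (B.tProj q).toLinearMap
    (LinearMap.range_eq_top.2 (B.tProj_surjective q))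
  refine ⟨(B.tProj q).toLinearMap ∘ₗ (A q).toLinearMap ∘ₗ R, fun p hp v => ?_⟩
  refine B.tProj_apply_eq hA hp.symm _ _ ?_
  exact congrArg (fun L : EM →ₗ[ℝ] EM => L (B.tProj p v : EM)) hR

/-- The endomorphism of `T_m M` induced by `A ∈ Aut_{TG} TP`: it maps `Tμ(p) v` to `Tμ(p)(A(p) v)`
for all `p` over `m` and `v ∈ T_p P`. -/
def lambdaMap (A : B.autTG) (m : M) : TangentSpace 𝓘(ℝ, EM) m →ₗ[ℝ] TangentSpace 𝓘(ℝ, EM) m :=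
  (B.exists_lambdaMap A.2 m).choose

theorem lambdaMap_tProj (A : B.autTG) (p : P) (v : TangentSpace 𝓘(ℝ, EP) p) :
    B.lambdaMap A (B.proj p) (B.tProj p v) = B.tProj p ((A : TangentAut EP P) p v) :=
  (B.exists_lambdaMap A.2 (B.proj p)).choose_spec p rfl v

theorem lambdaMap_mul (A C : B.autTG) (m : M) (w : TangentSpace 𝓘(ℝ, EM) m) :
    B.lambdaMap (A * C) m w = B.lambdaMap A m (B.lambdaMap C m w) := by
  obtain ⟨p, rfl⟩ := B.proj_surjective m
  obtain ⟨v, rfl⟩ := B.tProj_surjective p w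
  simp only [lambdaMap_tProj]
  rfl

theorem lambdaMap_one (m : M) (w : TangentSpace 𝓘(ℝ, EM) m) :
    B.lambdaMap 1 m w = w := by
  obtain ⟨p, rfl⟩ := B.proj_surjective m
  obtain ⟨v, rfl⟩ := B.tProj_surjective p w
  simp only [lambdaMap_tProj]
  rfl

variable [IsManifold 𝓘(ℝ, EM) ∞ M]

theorem contMDiff_lambdaMap (A : B.autTG) : ContMDiff 𝓘(ℝ, EM).tangent 𝓘(ℝ, EM).tangent ∞
    (fun v : TangentBundle 𝓘(ℝ, EM) M =>
      (⟨v.1, B.lambdaMap A v.1 v.2⟩ : TangentBundle 𝓘(ℝ, EM) M)) := by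
  intro v
  obtain ⟨U, s, γ, hU, hm, hs, -, h, -⟩ := B.exists_section v.1
  have hs' := hs.contMDiffOn_tangentMapWithin (m := ∞) (by simp) hU.uniqueMDiffOn
  have hV : IsOpen (Bundle.TotalSpace.proj ⁻¹' U : Set (TangentBundle 𝓘(ℝ, EM) M)) :=
    hU.preimage (FiberBundle.continuous_proj EM (TangentSpace 𝓘(ℝ, EM)))
  have hproj := B.contMDiff_proj.contMDiff_tangentMap (m := ∞) (by simp)
  have hc := (hproj.comp (A : TangentAut EP P).contMDiff_toFun).comp_contMDiffOn hs'
  refine (hc.congr ?_).contMDiffAt (hV.mem_nhds hm)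
  rintro ⟨x, w⟩ (hx : x ∈ U)
  have hsm : MDifferentiableAt 𝓘(ℝ, EM) 𝓘(ℝ, EP) s x :=
    (hs.contMDiffAt (hU.mem_nhds hx)).mdifferentiableAt (by simp)
  have h1 := mfderiv_comp_all (h := fun x : M => x) (B.mdifferentiableAt_proj (s x)) hsm rfl
    (Filter.eventually_of_mem (hU.mem_nhds hx) fun y hy => (h y hy).symm) w
  have h2 : (B.tProj (s x) (mfderiv 𝓘(ℝ, EM) 𝓘(ℝ, EP) s x w) : EM) = w :=
    h1.symm.trans (congrArg (fun L : EM →L[ℝ] EM => L w) (mfderiv_id (I := 𝓘(ℝ, EM)) (x := x)))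
  have h3 := (B.exists_lambdaMap A.2 x).choose_spec (s x) (h x hx)
    (mfderiv 𝓘(ℝ, EM) 𝓘(ℝ, EP) s x w)
  have h4 : (B.lambdaMap A x w : EM) = B.tProj (s x) ((A : TangentAut EP P) (s x)
      (mfderiv 𝓘(ℝ, EM) 𝓘(ℝ, EP) s x w)) := by
    refine Eq.trans ?_ h3
    exact congrArg (fun u : EM => (B.lambdaMap A x u : EM)) h2.symm
  have h5 : (mfderivWithin 𝓘(ℝ, EM) 𝓘(ℝ, EP) s U x : EM →L[ℝ] EP) = mfderiv 𝓘(ℝ, EM) 𝓘(ℝ, EP) s x :=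
    mfderivWithin_of_isOpen hU hx
  simp only [Function.comp_apply, tangentMapWithin, tangentMap]
  have key : ∀ (y : M) (a : EM) (b : EM), x = y → a = b →
      (⟨x, a⟩ : TangentBundle 𝓘(ℝ, EM) M) = ⟨y, b⟩ := by
    rintro y a b rfl rfl; rfl
  refine key _ _ _ (h x hx).symm (h4.trans ?_)
  exact congrArg (fun L : EM →L[ℝ] EP =>
    (B.tProj (s x) ((A : TangentAut EP P) (s x) (L w)) : EM)) h5.symm

/-- The group morphism `λ : Aut_{TG} TP → Aut_0 TM`, determined by
`λ(A)(μ(p)) (Tμ(p) v) = Tμ(p)(A(p) v)`. -/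
def lambda : B.autTG →* TangentAut EM M where
  toFun A :=
    { toFun := fun m => LinearEquiv.ofLinearMap (B.lambdaMap A m) (B.lambdaMap A⁻¹ m)
        (LinearMap.ext fun w => by
          change B.lambdaMap A m (B.lambdaMap A⁻¹ m w) = w
          rw [← lambdaMap_mul, mul_inv_cancel, lambdaMap_one])
        (LinearMap.ext fun w => by
          change B.lambdaMap A⁻¹ m (B.lambdaMap A m w) = w
          rw [← lambdaMap_mul, inv_mul_cancel, lambdaMap_one])
      contMDiff_toFun := B.contMDiff_lambdaMap A
      contMDiff_invFun := B.contMDiff_lambdaMap A⁻¹ }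
  map_one' := TangentAut.ext_apply fun m w => B.lambdaMap_one m w
  map_mul' A C := TangentAut.ext_apply fun m w => B.lambdaMap_mul A C m w

theorem lambda_tProj (A : B.autTG) (p : P) (v : TangentSpace 𝓘(ℝ, EP) p) :
    B.lambda A (B.proj p) (B.tProj p v) = B.tProj p ((A : TangentAut EP P) p v) :=
  B.lambdaMap_tProj A p v

end Lambda

section Sigma

variable [LieGroup 𝓘(ℝ, EG) ∞ G]

theorem contMDiff_fiber_one : ContMDiff 𝓘(ℝ, EG) 𝓘(ℝ, EG).tangent ∞
    (fun X : EG => (⟨1, X⟩ : TangentBundle 𝓘(ℝ, EG) G)) := by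
  intro X
  rw [Bundle.contMDiffAt_totalSpace]
  refine ⟨contMDiffAt_const, ?_⟩
  let L : EG →L[ℝ] EG := (trivializationAt EG (TangentSpace 𝓘(ℝ, EG)) (1 : G)).continuousLinearMapAt ℝ 1
  have hL : ContMDiff 𝓘(ℝ, EG) 𝓘(ℝ, EG) ∞ L := L.contMDiff
  refine (hL X).congr_of_eventuallyEq (Filter.Eventually.of_forall fun Y => ?_)
  have h1 : (1 : G) ∈ (trivializationAt EG (TangentSpace 𝓘(ℝ, EG)) (1 : G)).baseSet :=
    FiberBundle.mem_baseSet_trivializationAt' 1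
  exact (Bundle.Trivialization.continuousLinearMapAt_apply_of_mem ℝ _ h1 Y).symm

variable [IsManifold 𝓘(ℝ, EP) ∞ P]

/-- The tangent map of the action `P × G → P`. -/
theorem contMDiff_tangentAct :
    ContMDiff (𝓘(ℝ, EP).tangent.prod 𝓘(ℝ, EG).tangent) 𝓘(ℝ, EP).tangent ∞
      (fun x : TangentBundle 𝓘(ℝ, EP) P × TangentBundle 𝓘(ℝ, EG) G =>
        (⟨B.act x.1.1 x.2.1, B.tAct x.2.1 x.1.1 x.1.2 +
          mfderiv 𝓘(ℝ, EG) 𝓘(ℝ, EP) (B.act x.1.1) x.2.1 x.2.2⟩ : TangentBundle 𝓘(ℝ, EP) P)) := by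
  have h1 := (B.contMDiff_act.contMDiff_tangentMap (m := ∞) (by simp)).comp
    (contMDiff_equivTangentBundleProd_symm (I := 𝓘(ℝ, EP)) (M := P) (I' := 𝓘(ℝ, EG)) (M' := G))
  refine h1.congr fun x => ?_
  have ha : MDifferentiableAt (𝓘(ℝ, EP).prod 𝓘(ℝ, EG)) 𝓘(ℝ, EP)
      (fun x : P × G => B.act x.1 x.2) (x.1.1, x.2.1) :=
    (B.contMDiff_act.mdifferentiable (by simp)).mdifferentiableAt
  have h2 := mfderiv_prod_eq_add_apply (I := 𝓘(ℝ, EP)) (I' := 𝓘(ℝ, EG))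
    (v := (x.1.2, x.2.2)) ha
  exact congrArg (Bundle.TotalSpace.mk (F := EP) (E := TangentSpace 𝓘(ℝ, EP))
    (B.act x.1.1 x.2.1)) h2.symm

variable [IsManifold 𝓘(ℝ, EM) ∞ M]

variable {B} in
/-- The endomorphism `σ_α(Ã)(p) = Tκ_p(e) ∘ α_p + Γ_α(p) ∘ Ã(μ(p)) ∘ Tμ(p)` of `T_p P`; the first
summand is the projection onto the vertical space along the horizontal space. -/
def Conn.sigmaMap (α : B.Conn) (A : TangentAut EM M) (p : P) :
    TangentSpace 𝓘(ℝ, EP) p →ₗ[ℝ] TangentSpace 𝓘(ℝ, EP) p :=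
  (B.tOrbit p).toLinearMap ∘ₗ α.form p +
    α.horLift p ∘ₗ (A (B.proj p)).toLinearMap ∘ₗ (B.tProj p).toLinearMap

variable {B} (α : B.Conn)

theorem Conn.sigmaMap_apply (A : TangentAut EM M) (p : P) (v : TangentSpace 𝓘(ℝ, EP) p) :
    α.sigmaMap A p v = B.tOrbit p (α.form p v) + α.horLift p (A (B.proj p) (B.tProj p v)) := rfl

theorem Conn.form_sigmaMap (A : TangentAut EM M) (p : P) (v : TangentSpace 𝓘(ℝ, EP) p) :
    α.form p (α.sigmaMap A p v) = α.form p v := by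
  rw [sigmaMap_apply, map_add, α.form_tOrbit, α.form_horLift, add_zero]

theorem Conn.tProj_sigmaMap (A : TangentAut EM M) (p : P) (v : TangentSpace 𝓘(ℝ, EP) p) :
    B.tProj p (α.sigmaMap A p v) = A (B.proj p) (B.tProj p v) := by
  rw [sigmaMap_apply, map_add, B.tProj_tOrbit, α.tProj_horLift, zero_add]

theorem Conn.sigmaMap_mul (A C : TangentAut EM M) (p : P) (v : TangentSpace 𝓘(ℝ, EP) p) :
    α.sigmaMap (A * C) p v = α.sigmaMap A p (α.sigmaMap C p v) := by
  refine α.ext_vector _ ?_ ?_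
  · simp only [form_sigmaMap]
  · simp only [tProj_sigmaMap, TangentAut.mul_apply]

theorem Conn.sigmaMap_one (p : P) (v : TangentSpace 𝓘(ℝ, EP) p) : α.sigmaMap 1 p v = v := by
  refine α.ext_vector _ ?_ ?_
  · simp only [form_sigmaMap]
  · simp only [tProj_sigmaMap, TangentAut.one_apply]

theorem Conn.contMDiff_sigmaMap (A : TangentAut EM M) :
    ContMDiff 𝓘(ℝ, EP).tangent 𝓘(ℝ, EP).tangent ∞
      (fun v : TangentBundle 𝓘(ℝ, EP) P =>
        (⟨v.1, α.sigmaMap A v.1 v.2⟩ : TangentBundle 𝓘(ℝ, EP) P)) := by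
  intro v
  obtain ⟨U, s, γ, hU, hm, hs, hγ, h, h'⟩ := B.exists_section (B.proj v.1)
  have hs' := hs.contMDiffOn_tangentMapWithin (m := ∞) (by simp) hU.uniqueMDiffOn
  have hUp : IsOpen (B.proj ⁻¹' U) := hU.preimage B.contMDiff_proj.continuous
  set V : Set (TangentBundle 𝓘(ℝ, EP) P) := Bundle.TotalSpace.proj ⁻¹' (B.proj ⁻¹' U) with hVdef
  have hV : IsOpen V := hUp.preimage (FiberBundle.continuous_proj EP (TangentSpace 𝓘(ℝ, EP)))
  have hproj := B.contMDiff_proj.contMDiff_tangentMap (m := ∞) (by simp)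
  have hbase : ContMDiff 𝓘(ℝ, EP).tangent 𝓘(ℝ, EP) ∞
      (Bundle.TotalSpace.proj : TangentBundle 𝓘(ℝ, EP) P → P) :=
    Bundle.contMDiff_proj (TangentSpace 𝓘(ℝ, EP))
  have h1 := hs'.comp (s := V) (A.contMDiff_toFun.comp hproj).contMDiffOn fun x hx => hx
  have h2 := (Bundle.contMDiff_zeroSection ℝ (TangentSpace 𝓘(ℝ, EG) : G → Type _)
    (F := EG) (IB := 𝓘(ℝ, EG)) (n := ∞)).comp_contMDiffOn
    (hγ.comp (s := V) hbase.contMDiffOn fun x hx => hx)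
  -- a smooth, not necessarily horizontal, lift of `A (Tμ v)`
  have hu := B.contMDiff_tangentAct.comp_contMDiffOn (h1.prodMk h2)
  have h3 := α.contMDiff_form.comp_contMDiffOn hu
  have h4 := (contMDiff_fiber_one (G := G)).comp_contMDiffOn
    ((α.contMDiff_form.contMDiffOn (s := V)).sub h3)
  have h5 := B.contMDiff_tangentAct.comp_contMDiffOn (hu.prodMk h4)
  refine (h5.congr ?_).contMDiffAt (hV.mem_nhds hm)
  rintro ⟨p, w⟩ (hp : B.proj p ∈ U)
  have key : ∀ (q : P) (u : TangentSpace 𝓘(ℝ, EP) q), q = p →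
      (B.tProj q u : EM) = A (B.proj p) (B.tProj p w) →
      (⟨p, α.sigmaMap A p w⟩ : TangentBundle 𝓘(ℝ, EP) P) =
        ⟨B.act q 1, B.tAct 1 q u +
          mfderiv 𝓘(ℝ, EG) 𝓘(ℝ, EP) (B.act q) 1 (α.form p w - α.form q u : EG)⟩ := by
    rintro q u rfl hu
    have e1 : α.sigmaMap A q w = u + B.tOrbit q (α.form q w - α.form q u) := by
      refine α.ext_vector _ ?_ ?_
      · rw [α.form_sigmaMap, map_add, α.form_tOrbit, add_sub_cancel]
      · rw [α.tProj_sigmaMap, map_add, B.tProj_tOrbit, add_zero]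
        exact hu.symm
    have e2 : ∀ (y : P) (a b : EP), q = y → a = b →
        (⟨q, a⟩ : TangentBundle 𝓘(ℝ, EP) P) = ⟨y, b⟩ := by
      rintro y a b rfl rfl; rfl
    refine e2 _ _ _ (B.act_one q).symm ?_
    refine Eq.trans e1 ?_
    exact congrArg (fun a : TangentSpace 𝓘(ℝ, EP) q => a + B.tOrbit q (α.form q w - α.form q u))
      (B.tAct_one q u).symm
  refine key _ _ (h' p hp) ?_
  have hsm : MDifferentiableAt 𝓘(ℝ, EM) 𝓘(ℝ, EP) s (B.proj p) :=
    (hs.contMDiffAt (hU.mem_nhds hp)).mdifferentiableAt (by simp)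
  set w' : TangentSpace 𝓘(ℝ, EM) (B.proj p) := A (B.proj p) (B.tProj p w) with hw'
  have f1 := mfderiv_comp_all (h := fun x : M => x) (B.mdifferentiableAt_proj (s (B.proj p))) hsm rfl
    (Filter.eventually_of_mem (hU.mem_nhds hp) fun y hy => (h y hy).symm) w'
  have f2 : (B.tProj (s (B.proj p)) (mfderiv 𝓘(ℝ, EM) 𝓘(ℝ, EP) s (B.proj p) w') : EM) = w' :=
    f1.symm.trans (congrArg (fun L : EM →L[ℝ] EM => L w')
      (mfderiv_id (I := 𝓘(ℝ, EM)) (x := B.proj p)))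
  have f3 : (mfderivWithin 𝓘(ℝ, EM) 𝓘(ℝ, EP) s U (B.proj p) : EM →L[ℝ] EP) =
      mfderiv 𝓘(ℝ, EM) 𝓘(ℝ, EP) s (B.proj p) := mfderivWithin_of_isOpen hU hp
  have f4 : ∀ D : TangentSpace 𝓘(ℝ, EP) (s (B.proj p)),
      (B.tProj (s (B.proj p)) D : EM) = w' →
      (B.tProj (B.act (s (B.proj p)) (γ p)) (B.tAct (γ p) (s (B.proj p)) D +
        mfderiv 𝓘(ℝ, EG) 𝓘(ℝ, EP) (B.act (s (B.proj p))) (γ p) 0) : EM) = w' := by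
    intro D hD
    rw [map_zero, add_zero]
    exact (B.tProj_tAct _ _ _).trans hD
  refine f4 (mfderivWithin 𝓘(ℝ, EM) 𝓘(ℝ, EP) s U (B.proj p) w') ?_
  exact Eq.trans (congrArg (fun L : EM →L[ℝ] EP => (B.tProj (s (B.proj p)) (L w') : EM)) f3) f2

theorem Conn.sigmaMap_mul_inv (A : TangentAut EM M) (p : P) (v : TangentSpace 𝓘(ℝ, EP) p) :
    α.sigmaMap A p (α.sigmaMap A⁻¹ p v) = v := by
  rw [← sigmaMap_mul, mul_inv_cancel, sigmaMap_one]

theorem Conn.sigmaMap_inv_mul (A : TangentAut EM M) (p : P) (v : TangentSpace 𝓘(ℝ, EP) p) :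
    α.sigmaMap A⁻¹ p (α.sigmaMap A p v) = v := by
  rw [← sigmaMap_mul, inv_mul_cancel, sigmaMap_one]

/-- `σ_α(Ã)` as an automorphism of `TP`. -/
def Conn.sigmaAut (A : TangentAut EM M) : TangentAut EP P where
  toFun p := LinearEquiv.ofLinearMap (α.sigmaMap A p) (α.sigmaMap A⁻¹ p)
    (LinearMap.ext fun v => α.sigmaMap_mul_inv A p v)
    (LinearMap.ext fun v => α.sigmaMap_inv_mul A p v)
  contMDiff_toFun := α.contMDiff_sigmaMap A
  contMDiff_invFun := α.contMDiff_sigmaMap A⁻¹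

theorem Conn.sigmaAut_mem (A : TangentAut EM M) : α.sigmaAut A ∈ B.autTG := by
  refine B.mem_autTG_of (fun p X => ?_) (fun g p v => ?_)
  · change α.sigmaMap A p _ = _
    rw [sigmaMap_apply, α.form_tOrbit, B.tProj_tOrbit, map_zero, map_zero, add_zero]
  · change α.sigmaMap A _ _ = B.tAct g p (α.sigmaMap A p v)
    rw [sigmaMap_apply, sigmaMap_apply, map_add, B.tAct_tOrbit, α.form_tAct]
    congr 1
    refine α.horLift_act g p _ _ ?_
    exact tangentAut_congr A (B.proj_act p g) (B.tProj_tAct g p v)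

/-- The group morphism `σ_α : Aut_0 TM → Aut_{TG} TP`. -/
def Conn.sigma : TangentAut EM M →* B.autTG where
  toFun A := ⟨α.sigmaAut A, α.sigmaAut_mem A⟩
  map_one' := Subtype.ext (TangentAut.ext_apply fun p v => α.sigmaMap_one p v)
  map_mul' A C := Subtype.ext (TangentAut.ext_apply fun p v => α.sigmaMap_mul A C p v)

end Sigma

end SmoothPrincipalBundle

end

/-!
At every `p`, a vector of `T_p P` is determined by its vertical component `α_p v` and its projection
`Tμ(p) v`. Since `A` carries `α` to `A • α` and covers `λ(A)`, it follows that `A ∈ Aut_{TG} TP` is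
determined by the pair `(A • α, λ(A))`. As `Aut_N TP` is the kernel of `λ`, it acts freely; as
`σ_α` is a section of `λ` with values in the stabilizer of `α`, an `A` fixing `α` equals
`σ_α(λ(A))`. For transitivity, the difference `θ = α - β` of two connections kills vertical
vectors, so `v ↦ v + Tκ_p(e) (θ v)` is an element of `Aut_N TP`, with inverse given by `-θ`; it
carries `α` to `α - θ = β`.
-/

namespace SmoothPrincipalBundle

variable {EG : Type*} [NormedAddCommGroup EG] [NormedSpace ℝ EG]
  {G : Type*} [TopologicalSpace G] [ChartedSpace EG G] [Group G]
  {EP : Type*} [NormedAddCommGroup EP] [NormedSpace ℝ EP]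
  {P : Type*} [TopologicalSpace P] [ChartedSpace EP P] [IsManifold 𝓘(ℝ, EP) ∞ P]
  {EM : Type*} [NormedAddCommGroup EM] [NormedSpace ℝ EM]
  {M : Type*} [TopologicalSpace M] [ChartedSpace EM M]
  {B : SmoothPrincipalBundle EG G EP P EM M}

theorem contMDiff_add_tOrbit [LieGroup 𝓘(ℝ, EG) ∞ G] (B : SmoothPrincipalBundle EG G EP P EM M) :
    ContMDiff (𝓘(ℝ, EP).tangent.prod 𝓘(ℝ, EG)) 𝓘(ℝ, EP).tangent ∞
      (fun x : TangentBundle 𝓘(ℝ, EP) P × EG =>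
        (⟨x.1.1, x.1.2 + B.tOrbit x.1.1 x.2⟩ : TangentBundle 𝓘(ℝ, EP) P)) := by
  have smooth_act_one := B.contMDiff_tangentAct.comp
    (contMDiff_fst.prodMk ((contMDiff_fiber_one (G := G)).comp contMDiff_snd))
  refine smooth_act_one.congr fun x => ?_
  exact congrArg₂ (fun (q : P) (u : EP) => (⟨q, u⟩ : TangentBundle 𝓘(ℝ, EP) P))
    (B.act_one x.1.1).symm
    (congrArg (fun u : TangentSpace 𝓘(ℝ, EP) x.1.1 => u + B.tOrbit x.1.1 x.2)
      (B.tAct_one x.1.1 x.1.2).symm)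

variable (B) in
/-- A tensorial one-form on the principal bundle: a smooth `T_e G`-valued one-form `θ` on `P` which
vanishes on vertical vectors and satisfies `θ_{pg} ∘ Tκ_g(p) = Ad_{g⁻¹} ∘ θ_p`. These are the
differences of connections. -/
structure TensorialForm where
  form : ∀ p : P, TangentSpace 𝓘(ℝ, EP) p →ₗ[ℝ] GroupLieAlgebra 𝓘(ℝ, EG) G
  contMDiff_form : ContMDiff (M' := EG) 𝓘(ℝ, EP).tangent 𝓘(ℝ, EG) ∞
    (fun v : TangentBundle 𝓘(ℝ, EP) P => form v.1 v.2)
  form_tOrbit : ∀ (p : P) (X : GroupLieAlgebra 𝓘(ℝ, EG) G), form p (B.tOrbit p X) = 0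
  form_tAct : ∀ (p : P) (g : G) (v : TangentSpace 𝓘(ℝ, EP) p),
    form (B.act p g) (B.tAct g p v) = Ad g⁻¹ (form p v)

namespace TensorialForm

noncomputable instance : Neg B.TensorialForm where
  neg θ :=
    { form := fun p => -θ.form p
      contMDiff_form := θ.contMDiff_form.neg
      form_tOrbit := fun p X => by rw [LinearMap.neg_apply, θ.form_tOrbit, neg_zero]
      form_tAct := fun p g v => by
        rw [LinearMap.neg_apply, LinearMap.neg_apply, θ.form_tAct, map_neg] }

theorem neg_form (θ : B.TensorialForm) (p : P) : (-θ).form p = -θ.form p := rfl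

/-- The vertical shear `v ↦ v + Tκ_p(e) (θ v)` of `T_p P` along a tensorial form `θ`. -/
noncomputable def shearMap (θ : B.TensorialForm) (p : P) :
    TangentSpace 𝓘(ℝ, EP) p →ₗ[ℝ] TangentSpace 𝓘(ℝ, EP) p :=
  LinearMap.id + (B.tOrbit p).toLinearMap ∘ₗ θ.form p

theorem shearMap_apply (θ : B.TensorialForm) (p : P) (v : TangentSpace 𝓘(ℝ, EP) p) :
    θ.shearMap p v = v + B.tOrbit p (θ.form p v) := rfl

theorem shearMap_shearMap (θ η : B.TensorialForm) (p : P) (v : TangentSpace 𝓘(ℝ, EP) p) :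
    θ.shearMap p (η.shearMap p v) = v + B.tOrbit p (η.form p v + θ.form p v) := by
  rw [shearMap_apply θ, shearMap_apply η, map_add, θ.form_tOrbit, add_zero, add_assoc, ← map_add]

theorem shearMap_shearMap_neg (θ : B.TensorialForm) (p : P) (v : TangentSpace 𝓘(ℝ, EP) p) :
    θ.shearMap p ((-θ).shearMap p v) = v := by
  rw [shearMap_shearMap, neg_form, LinearMap.neg_apply, neg_add_cancel, map_zero, add_zero]

theorem shearMap_neg_shearMap (θ : B.TensorialForm) (p : P) (v : TangentSpace 𝓘(ℝ, EP) p) :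
    (-θ).shearMap p (θ.shearMap p v) = v := by
  rw [shearMap_shearMap, neg_form, LinearMap.neg_apply, add_neg_cancel, map_zero, add_zero]

theorem shearMap_tOrbit (θ : B.TensorialForm) (p : P) (X : GroupLieAlgebra 𝓘(ℝ, EG) G) :
    θ.shearMap p (B.tOrbit p X) = B.tOrbit p X := by
  rw [shearMap_apply, θ.form_tOrbit, map_zero, add_zero]

theorem tProj_shearMap (θ : B.TensorialForm) (p : P) (v : TangentSpace 𝓘(ℝ, EP) p) :
    B.tProj p (θ.shearMap p v) = B.tProj p v := by
  rw [shearMap_apply, map_add, B.tProj_tOrbit, add_zero]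

variable [LieGroup 𝓘(ℝ, EG) ∞ G]

theorem shearMap_tAct (θ : B.TensorialForm) (g : G) (p : P) (v : TangentSpace 𝓘(ℝ, EP) p) :
    θ.shearMap (B.act p g) (B.tAct g p v) = B.tAct g p (θ.shearMap p v) := by
  rw [shearMap_apply, shearMap_apply, map_add, B.tAct_tOrbit, θ.form_tAct]

theorem contMDiff_shearMap (θ : B.TensorialForm) :
    ContMDiff 𝓘(ℝ, EP).tangent 𝓘(ℝ, EP).tangent ∞
      (fun v : TangentBundle 𝓘(ℝ, EP) P =>
        (⟨v.1, θ.shearMap v.1 v.2⟩ : TangentBundle 𝓘(ℝ, EP) P)) :=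
  B.contMDiff_add_tOrbit.comp (contMDiff_id.prodMk θ.contMDiff_form)

/-- The vertical shear along a tensorial form as an automorphism of `TP`. -/
noncomputable def shearAut (θ : B.TensorialForm) : TangentAut EP P where
  toFun p := LinearEquiv.ofLinearMap (θ.shearMap p) ((-θ).shearMap p)
    (LinearMap.ext (θ.shearMap_shearMap_neg p)) (LinearMap.ext (θ.shearMap_neg_shearMap p))
  contMDiff_toFun := θ.contMDiff_shearMap
  contMDiff_invFun := (-θ).contMDiff_shearMap

theorem shearAut_mem_autTG (θ : B.TensorialForm) : θ.shearAut ∈ B.autTG :=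
  B.mem_autTG_of θ.shearMap_tOrbit θ.shearMap_tAct

/-- The vertical shear along a tensorial form as an element of `Aut_N TP`. -/
noncomputable def shear (θ : B.TensorialForm) : B.autN :=
  ⟨⟨θ.shearAut, θ.shearAut_mem_autTG⟩, fun p v => by
    change B.tProj p (θ.shearMap p v - v) = 0
    rw [map_sub, tProj_shearMap, sub_self]⟩

theorem form_shear_smul (θ : B.TensorialForm) (α : B.Conn) (p : P) :
    (θ.shear • α).form p = α.form p - θ.form p := by
  ext v
  change α.form p ((-θ).shearMap p v) = α.form p v - θ.form p v
  rw [shearMap_apply, map_add, α.form_tOrbit, neg_form, LinearMap.neg_apply, sub_eq_add_neg]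

end TensorialForm

namespace Conn

/-- The difference `α - β` of two connections, as a tensorial form. -/
noncomputable def difference (α β : B.Conn) : B.TensorialForm where
  form p := α.form p - β.form p
  contMDiff_form := α.contMDiff_form.sub β.contMDiff_form
  form_tOrbit p X := by rw [LinearMap.sub_apply, α.form_tOrbit, β.form_tOrbit, sub_self]
  form_tAct p g v := by
    rw [LinearMap.sub_apply, LinearMap.sub_apply, α.form_tAct, β.form_tAct, map_sub]

theorem shear_difference_smul [LieGroup 𝓘(ℝ, EG) ∞ G] (α β : B.Conn) :
    (α.difference β).shear • α = β :=
  Conn.ext (funext fun p =>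
    ((α.difference β).form_shear_smul α p).trans (sub_sub_cancel (α.form p) (β.form p)))

end Conn

theorem smul_form_apply (A : B.autTG) (α : B.Conn) (p : P) (v : TangentSpace 𝓘(ℝ, EP) p) :
    (A • α).form p ((A : TangentAut EP P) p v) = α.form p v := by
  rw [smul_form, LinearEquiv.symm_apply_apply]

variable [LieGroup 𝓘(ℝ, EG) ∞ G] [IsManifold 𝓘(ℝ, EM) ∞ M]

theorem apply_horLift (α : B.Conn) (A : B.autTG) (p : P)
    (w : TangentSpace 𝓘(ℝ, EM) (B.proj p)) :
    (A : TangentAut EP P) p (α.horLift p w) = (A • α).horLift p (B.lambda A (B.proj p) w) := by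
  refine (A • α).ext_vector p ?_ ?_
  · rw [smul_form_apply, α.form_horLift, Conn.form_horLift]
  · rw [← lambda_tProj, α.tProj_horLift, Conn.tProj_horLift]

theorem ker_lambda (B : SmoothPrincipalBundle EG G EP P EM M) : B.lambda.ker = B.autN := by
  ext A
  constructor
  · intro hA p v
    change B.tProj p ((A : TangentAut EP P) p v - v) = 0
    rw [map_sub, ← lambda_tProj, MonoidHom.mem_ker.1 hA, TangentAut.one_apply, sub_self]
  · intro hA
    refine MonoidHom.mem_ker.2 (TangentAut.ext_apply fun m w => ?_)
    obtain ⟨p, rfl⟩ := B.proj_surjective m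
    obtain ⟨v, rfl⟩ := B.tProj_surjective p w
    have vertical : B.tProj p ((A : TangentAut EP P) p v - v) = 0 := hA p v
    rw [lambda_tProj, TangentAut.one_apply, ← sub_eq_zero, ← map_sub, vertical]

namespace Conn

theorem eq_of_smul_eq_of_lambda_eq (α : B.Conn) {A C : B.autTG} (hsmul : A • α = C • α)
    (hlambda : B.lambda A = B.lambda C) : A = C := by
  refine Subtype.ext (TangentAut.ext_apply fun p v => (A • α).ext_vector p ?_ ?_)
  · rw [smul_form_apply, hsmul, smul_form_apply]
  · rw [← lambda_tProj, hlambda, lambda_tProj]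

theorem eq_one_of_smul_eq (α : B.Conn) {A : B.autN} (hA : A • α = α) : A = 1 := by
  have lambda_eq_one : B.lambda (A : B.autTG) = 1 :=
    MonoidHom.mem_ker.1 (B.ker_lambda.ge A.2)
  exact Subtype.ext (α.eq_of_smul_eq_of_lambda_eq (hA.trans (one_smul B.autTG α).symm)
    (lambda_eq_one.trans (map_one B.lambda).symm))

theorem sigma_smul (α : B.Conn) (C : TangentAut EM M) : α.sigma C • α = α :=
  Conn.ext_apply fun p v => α.form_sigmaMap C⁻¹ p v

theorem lambda_sigma (α : B.Conn) (C : TangentAut EM M) : B.lambda (α.sigma C) = C := by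
  refine TangentAut.ext_apply fun m w => ?_
  obtain ⟨p, rfl⟩ := B.proj_surjective m
  obtain ⟨v, rfl⟩ := B.tProj_surjective p w
  exact (B.lambda_tProj (α.sigma C) p v).trans (α.tProj_sigmaMap C p v)

theorem stabilizer_eq_range_sigma (α : B.Conn) :
    MulAction.stabilizer B.autTG α = α.sigma.range := by
  ext A
  rw [MulAction.mem_stabilizer_iff]
  constructor
  · intro hA
    exact ⟨B.lambda A, α.eq_of_smul_eq_of_lambda_eq ((α.sigma_smul _).trans hA.symm)
      (α.lambda_sigma _)⟩
  · rintro ⟨C, rfl⟩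
    exact α.sigma_smul C

end Conn

end SmoothPrincipalBundle

theorem proposition3_general
    {EG : Type*} [NormedAddCommGroup EG] [NormedSpace ℝ EG]
    {G : Type*} [TopologicalSpace G] [ChartedSpace EG G] [Group G] [LieGroup 𝓘(ℝ, EG) ∞ G]
    {EP : Type*} [NormedAddCommGroup EP] [NormedSpace ℝ EP]
    {P : Type*} [TopologicalSpace P] [ChartedSpace EP P] [IsManifold 𝓘(ℝ, EP) ∞ P]
    {EM : Type*} [NormedAddCommGroup EM] [NormedSpace ℝ EM]
    {M : Type*} [TopologicalSpace M] [ChartedSpace EM M] [IsManifold 𝓘(ℝ, EM) ∞ M]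
    (B : SmoothPrincipalBundle EG G EP P EM M) :
    (∀ α β : B.Conn, ∃ A : B.autTG, A • α = β) ∧
    (∀ (α : B.Conn) (A : B.autTG) (p : P) (w : TangentSpace 𝓘(ℝ, EM) (B.proj p)),
      (A : TangentAut EP P) p (α.horLift p w) =
        (A • α).horLift p (B.lambda A (B.proj p) w)) ∧
    ((∀ (A : B.autN) (α : B.Conn), A • α = α → A = 1) ∧
      (∀ α β : B.Conn, ∃ A : B.autN, A • α = β)) ∧
    (∀ α : B.Conn, MulAction.stabilizer B.autTG α = α.sigma.range) :=
  ⟨fun α β => ⟨(α.difference β).shear, α.shear_difference_smul β⟩,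
    SmoothPrincipalBundle.apply_horLift,
    ⟨fun _ α hA => α.eq_one_of_smul_eq hA,
      fun α β => ⟨(α.difference β).shear, α.shear_difference_smul β⟩⟩,
    fun α => α.stabilizer_eq_range_sigma⟩

/-- Let `B` be a smooth principal `G`-bundle `P → M`.
(i) `Aut_{TG} TP` acts transitively on the connections by `φ_A(α) = α ∘ A⁻¹`.
(ii) `A(p) ∘ Γ_α(p) = Γ_{φ_A(α)}(p) ∘ λ(A)(μ(p))`.
(iii) `Aut_N TP` acts freely and transitively on the connections.
(iv) The stabilizer of `α` in `Aut_{TG} TP` is `σ_α(Aut_0 TM)`. -/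
theorem proposition3
    {EG : Type*} [NormedAddCommGroup EG] [NormedSpace ℝ EG] [FiniteDimensional ℝ EG]
    {G : Type*} [TopologicalSpace G] [ChartedSpace EG G] [Group G] [LieGroup 𝓘(ℝ, EG) ∞ G]
    {EP : Type*} [NormedAddCommGroup EP] [NormedSpace ℝ EP] [FiniteDimensional ℝ EP]
    {P : Type*} [TopologicalSpace P] [ChartedSpace EP P] [IsManifold 𝓘(ℝ, EP) ∞ P]
    {EM : Type*} [NormedAddCommGroup EM] [NormedSpace ℝ EM] [FiniteDimensional ℝ EM]
    {M : Type*} [TopologicalSpace M] [ChartedSpace EM M] [IsManifold 𝓘(ℝ, EM) ∞ M]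
    (B : SmoothPrincipalBundle EG G EP P EM M) :
    (∀ α β : B.Conn, ∃ A : B.autTG, A • α = β) ∧
    (∀ (α : B.Conn) (A : B.autTG) (p : P) (w : TangentSpace 𝓘(ℝ, EM) (B.proj p)),
      (A : TangentAut EP P) p (α.horLift p w) =
        (A • α).horLift p (B.lambda A (B.proj p) w)) ∧
    ((∀ (A : B.autN) (α : B.Conn), A • α = α → A = 1) ∧
      (∀ α β : B.Conn, ∃ A : B.autN, A • α = β)) ∧
    (∀ α : B.Conn, MulAction.stabilizer B.autTG α = α.sigma.range) :=
  proposition3_general B
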